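/- Let $K(k)=\frac{\pi}{2}\,{}_2F_1\!\left(\tfrac12,\tfrac12;1;k^2\right)$, $0\le k<1$, denote the complete elliptic integral of the first kind, and let $(a)_n=a(a+1)\cdots(a+n-1)$, $(a)_0=1$, be the Pochhammer symbol. Then the following series converges and $$\sum_{n=0}^\infty \frac{\binom{4n}{2n}\left(\frac14\right)_n^2}{(2n)!}\,\frac{5+92n+3120n^2-4032n^3}{2^{8n}}=\frac{8}{K(1/\sqrt2)}=\frac{32\sqrt{\pi}}{\Gamma(\frac14)^2}.$$ -/

import Mathlib

/-- The complete elliptic integral of the first kind with modulus `x`, for `0 ≤ x < 1`: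
`K(x) = (π / 2) · ₂F₁(1/2, 1/2; 1; x²)`. -/
noncomputable def ellipticK (x : ℝ) : ℝ :=
  Real.pi / 2 * ordinaryHypergeometric (1 / 2 : ℝ) (1 / 2 : ℝ) (1 : ℝ) (x ^ 2)

/-!
Both assertions rest on a hypergeometric sum `S(x)` that contains a free parameter `x`. A
Wilf-Zeilberger certificate relates `S(x)` to the sum with a shifted parameter through an explicit
factor, and as the parameter tends to infinity the term of index zero dominates. Hence `S(x)` is an
infinite product, which `tendsto_prod_shift_div` evaluates by Euler's limit formula for `Γ`.

* For `K(1/√2)` the sum is `∑ (1/2)_n² / (n! (c)_n 2ⁿ)` at `c = 1`, with `c` shifted by `2`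
  (`gaussTerm`). This is a case of Gauss's second summation theorem and gives
  `K(1/√2) = Γ(1/4)² / (4 √π)`, see `ellipticK_one_div_sqrt_two`.
* For the series of the theorem, the alternating sum
  `∑ (-1)^k (a + 2k) (a)_k (1/4)_k (3/4)_k / (k! (a + 3/4)_k (a + 1/4)_k)` can be accelerated by
  the parameter shift `(a; b, c, d) ↦ (a + 3; b + 1, c + 1, d + 1)`, as for Ramanujan's series for
  `1/π` with the linear factor `42 n + 5`. The accelerated sum (`accSummand`) converges absolutely,
  and its own shift `a ↦ a + 1` has the certificate `2 n` (`accSummand_shift`), so neither the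
  alternating sum nor its acceleration enters the proof. At `a = 1/4` the accelerated sum differs
  from the series of the theorem by a telescoping series (`target_eq_accSummand_add`).
-/

open Filter Topology Finset

/-! ### Infinite products and telescoping series -/

/-- Adding the differences of a summable sequence that starts at `0` does not change the sum. -/
theorem hasSum_add_telescope {f g h : ℕ → ℝ} {s : ℝ} (hg : HasSum g s) (hh : Summable h)
    (h0 : h 0 = 0) (hf : ∀ n, f n = g n + (h (n + 1) - h n)) : HasSum f s := by
  obtain ⟨t, ht⟩ := hh
  have h1 : HasSum (fun n => h (n + 1)) t := by
    simpa [h0] using (hasSum_nat_add_iff' 1).mpr ht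
  have h2 := hg.add (h1.sub ht)
  rw [sub_self, add_zero] at h2
  exact h2.congr_fun hf

/-- The quotient of Pochhammer symbols `(a)_m (b)_m / ((c)_m (d)_m)` converges: the condition
`a + b = c + d` makes the powers of `n` in Euler's limit formula cancel. -/
theorem tendsto_prod_shift_div {a b c d : ℝ} (ha : 0 < a) (hb : 0 < b) (hc : 0 < c) (hd : 0 < d)
    (h : a + b = c + d) :
    Tendsto (fun m : ℕ => ∏ j ∈ range m, ((j + a) * (j + b)) / ((j + c) * (j + d))) atTop
      (𝓝 (Real.Gamma c * Real.Gamma d / (Real.Gamma a * Real.Gamma b))) := by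
  rw [← tendsto_add_atTop_iff_nat 1]
  have hlim := ((Real.GammaSeq_tendsto_Gamma c).mul (Real.GammaSeq_tendsto_Gamma d)).div
    ((Real.GammaSeq_tendsto_Gamma a).mul (Real.GammaSeq_tendsto_Gamma b))
    (mul_ne_zero (Real.Gamma_pos_of_pos ha).ne' (Real.Gamma_pos_of_pos hb).ne')
  refine hlim.congr' ?_
  filter_upwards [eventually_gt_atTop 0] with n hn
  have hn' : (0 : ℝ) < n := by exact_mod_cast hn
  have hprod : ∀ x : ℝ, 0 < x → 0 < ∏ j ∈ range (n + 1), (x + j) := fun x hx =>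
    prod_pos fun j _ => by positivity
  have hA := hprod a ha
  have hB := hprod b hb
  have hC := hprod c hc
  have hD := hprod d hd
  have hpow : (n : ℝ) ^ a * (n : ℝ) ^ b = (n : ℝ) ^ c * (n : ℝ) ^ d := by
    rw [← Real.rpow_add hn', ← Real.rpow_add hn', h]
  have hpa : 0 < (n : ℝ) ^ a := by positivity
  have hpb : 0 < (n : ℝ) ^ b := by positivity
  have hfac : (0 : ℝ) < n.factorial := by positivity
  simp only [Pi.div_apply, Real.GammaSeq]
  rw [prod_div_distrib, prod_mul_distrib, prod_mul_distrib]
  simp only [add_comm _ a, add_comm _ b, add_comm _ c, add_comm _ d]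
  rw [div_mul_div_comm, div_mul_div_comm, mul_mul_mul_comm, mul_mul_mul_comm (_ ^ a), ← hpow]
  field_simp

/-- A series of nonnegative terms whose terms after the first are at most `B / 2 ^ n` is
within `2 * B` of its first term. -/
theorem abs_tsum_sub_zero_le {f : ℕ → ℝ} {B : ℝ} (hpos : ∀ n, 0 ≤ f n)
    (hf : ∀ n, f (n + 1) ≤ B * (1 / 2) ^ n) : Summable f ∧ |∑' n, f n - f 0| ≤ 2 * B := by
  have hgeo : HasSum (fun n : ℕ => B * (1 / 2 : ℝ) ^ n) (B * 2) := hasSum_geometric_two.mul_left B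
  have hs1 : Summable fun n => f (n + 1) :=
    Summable.of_nonneg_of_le (fun n => hpos _) hf hgeo.summable
  have hs : Summable f := (summable_nat_add_iff 1).mp hs1
  refine ⟨hs, ?_⟩
  rw [hs.tsum_eq_zero_add, add_sub_cancel_left, abs_of_nonneg (tsum_nonneg fun n => hpos _),
    mul_comm, ← hgeo.tsum_eq]
  exact hs1.tsum_le_tsum hf hgeo.summable

/-! ### The value of `K(1/√2)` -/

/-- The `n`-th term of `₂F₁(1/2, 1/2; c; 1/2)`. -/
noncomputable def gaussTerm (c : ℝ) (n : ℕ) : ℝ :=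
  ∏ i ∈ range n, ((i : ℝ) + 1 / 2) ^ 2 / (2 * (i + 1) * (c + i))

theorem gaussTerm_zero (c : ℝ) : gaussTerm c 0 = 1 := by simp [gaussTerm]

theorem gaussTerm_succ (c : ℝ) (n : ℕ) :
    gaussTerm c (n + 1) = gaussTerm c n * (((n : ℝ) + 1 / 2) ^ 2 / (2 * (n + 1) * (c + n))) :=
  prod_range_succ _ _

theorem gaussTerm_nonneg {c : ℝ} (hc : 0 < c) (n : ℕ) : 0 ≤ gaussTerm c n :=
  prod_nonneg fun i _ => by positivity

theorem gaussTerm_add_two {c : ℝ} (hc : 0 < c) (n : ℕ) :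
    gaussTerm (c + 2) n = gaussTerm c n * (c * (c + 1) / ((c + n) * (c + n + 1))) := by
  induction n with
  | zero => simp only [gaussTerm_zero, Nat.cast_zero, add_zero]; field_simp
  | succ n ih =>
    rw [gaussTerm_succ, gaussTerm_succ, ih]
    push_cast
    field_simp
    ring

theorem gaussTerm_succ_le {c : ℝ} (hc : 1 ≤ c) (n : ℕ) :
    gaussTerm c (n + 1) ≤ 1 / c * (1 / 2) ^ n := by
  induction n with
  | zero =>
    rw [gaussTerm_succ, gaussTerm_zero]
    have : 0 < c := by linarith
    norm_num
    field_simp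
    norm_num
  | succ n ih =>
    rw [gaussTerm_succ, pow_succ (1 / 2 : ℝ), ← mul_assoc]
    have : 0 < c := by linarith
    refine mul_le_mul ih ?_ (by positivity) (by positivity)
    push_cast
    rw [div_le_div_iff₀ (by positivity) (by positivity)]
    nlinarith [mul_nonneg (Nat.cast_nonneg (α := ℝ) n) (sub_nonneg.mpr hc)]

theorem summable_gaussTerm {c : ℝ} (hc : 1 ≤ c) : Summable (gaussTerm c) :=
  (abs_tsum_sub_zero_le (gaussTerm_nonneg (by linarith)) (gaussTerm_succ_le hc)).1

/-- The Wilf-Zeilberger certificate `2 n / (c + n)` for the shift `c ↦ c + 2`. -/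
theorem tsum_gaussTerm_add_two {c : ℝ} (hc : 1 ≤ c) :
    ∑' n, gaussTerm c n
      = (c + 1 / 2) ^ 2 / (c * (c + 1)) * ∑' n, gaussTerm (c + 2) n := by
  have hc0 : 0 < c := by linarith
  have hsum : Summable fun n : ℕ => 2 * n / (c + n) * gaussTerm c n := by
    refine Summable.of_nonneg_of_le
      (fun n => mul_nonneg (by positivity) (gaussTerm_nonneg hc0 n)) (fun n => ?_)
      ((summable_gaussTerm hc).mul_left 2)
    refine mul_le_mul_of_nonneg_right ?_ (gaussTerm_nonneg hc0 n)
    rw [div_le_iff₀ (by positivity)]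
    linarith
  refine (((hasSum_add_telescope (summable_gaussTerm hc).hasSum hsum (by simp)) ?_).unique
    ((summable_gaussTerm (by linarith : 1 ≤ c + 2)).hasSum.mul_left _))
  intro n
  rw [gaussTerm_add_two hc0, gaussTerm_succ]
  push_cast
  field_simp
  ring

theorem tsum_gaussTerm_one (m : ℕ) :
    ∑' n, gaussTerm 1 n =
      (∏ j ∈ range m, (((j : ℝ) + 3 / 4) * (j + 3 / 4)) / ((j + 1 / 2) * (j + 1)))
        * ∑' n, gaussTerm (1 + 2 * m) n := by
  induction m with
  | zero => simp
  | succ m ih =>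
    rw [ih, prod_range_succ, mul_assoc,
      tsum_gaussTerm_add_two (by linarith [Nat.cast_nonneg (α := ℝ) m] : 1 ≤ 1 + 2 * (m : ℝ)),
      show (1 + 2 * (m : ℝ) + 2) = 1 + 2 * ((m + 1 : ℕ) : ℝ) by push_cast; ring]
    congr 2
    field_simp
    ring

theorem tendsto_tsum_gaussTerm :
    Tendsto (fun m : ℕ => ∑' n, gaussTerm (1 + 2 * m) n) atTop (𝓝 1) := by
  rw [tendsto_iff_norm_sub_tendsto_zero]
  have hlim : Tendsto (fun m : ℕ => 2 * (1 / ((m : ℝ) + 1))) atTop (𝓝 0) := by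
    simpa using (tendsto_one_div_add_atTop_nhds_zero_nat (𝕜 := ℝ)).const_mul 2
  refine squeeze_zero (fun _ => norm_nonneg _) (fun m => ?_) hlim
  have hm : (0 : ℝ) ≤ m := Nat.cast_nonneg m
  have h := (abs_tsum_sub_zero_le (gaussTerm_nonneg (by linarith))
    (gaussTerm_succ_le (by linarith : 1 ≤ 1 + 2 * (m : ℝ)))).2
  rw [gaussTerm_zero] at h
  refine h.trans ?_
  gcongr 2 * ?_
  exact one_div_le_one_div_of_le (by positivity) (by linarith)

theorem tsum_gaussTerm_eq :
    ∑' n, gaussTerm 1 n = Real.sqrt Real.pi / Real.Gamma (3 / 4) ^ 2 := by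
  have h := (tendsto_prod_shift_div (a := 3 / 4) (b := 3 / 4) (c := 1 / 2) (d := 1)
    (by norm_num) (by norm_num) (by norm_num) (by norm_num) (by norm_num)).mul
    tendsto_tsum_gaussTerm
  rw [Real.Gamma_one_half_eq, Real.Gamma_one, mul_one, mul_one, ← sq] at h
  exact tendsto_nhds_unique (tendsto_const_nhds.congr fun m => tsum_gaussTerm_one m) h

theorem ellipticK_eq_tsum :
    ellipticK (1 / Real.sqrt 2) = Real.pi / 2 * ∑' n, gaussTerm 1 n := by
  rw [ellipticK, ordinaryHypergeometric_eq_tsum, div_pow, Real.sq_sqrt (by norm_num)]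
  congr 1
  refine tsum_congr fun n => ?_
  induction n with
  | zero => simp [gaussTerm_zero]
  | succ n ih =>
    rw [gaussTerm_succ, ← ih]
    simp only [ascPochhammer_succ_eval, ascPochhammer_eval_one, Nat.factorial_succ, smul_eq_mul]
    have : (n.factorial : ℝ) ≠ 0 := by positivity
    push_cast
    field_simp
    ring

theorem Gamma_one_quarter_mul_Gamma_three_quarters :
    Real.Gamma (1 / 4) * Real.Gamma (3 / 4) = Real.pi * Real.sqrt 2 := by
  have h := Real.Gamma_mul_Gamma_one_sub (1 / 4)
  rw [show (1 - 1 / 4 : ℝ) = 3 / 4 by norm_num, mul_one_div, Real.sin_pi_div_four] at h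
  rw [h]
  have h2 : Real.sqrt 2 ^ 2 = 2 := Real.sq_sqrt (by norm_num)
  field_simp
  linarith

theorem ellipticK_one_div_sqrt_two :
    ellipticK (1 / Real.sqrt 2) = Real.Gamma (1 / 4) ^ 2 / (4 * Real.sqrt Real.pi) := by
  rw [ellipticK_eq_tsum, tsum_gaussTerm_eq]
  have h1 : 0 < Real.Gamma (3 / 4) := Real.Gamma_pos_of_pos (by norm_num)
  have h2 : 0 < Real.sqrt Real.pi := Real.sqrt_pos.mpr Real.pi_pos
  have h3 : Real.sqrt Real.pi ^ 2 = Real.pi := Real.sq_sqrt Real.pi_pos.le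
  have h4 : (Real.Gamma (1 / 4) * Real.Gamma (3 / 4)) ^ 2 = 2 * Real.pi ^ 2 := by
    rw [Gamma_one_quarter_mul_Gamma_three_quarters, mul_pow, Real.sq_sqrt (by norm_num)]
    ring
  rw [mul_pow] at h4
  rw [mul_div_assoc', div_eq_div_iff (by positivity) (by positivity), h4]
  linear_combination 2 * Real.pi * h3

/-! ### The accelerated series -/

/-- The hypergeometric term
`(a)_n² (1/4)_n² (3/4)_n² / ((2n)! (a + 1/4)_{2n} (a + 3/4)_{2n})`, as the product of its term
ratios. -/
noncomputable def accTerm (a : ℝ) (n : ℕ) : ℝ :=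
  ∏ i ∈ range n, (((i : ℝ) + a) ^ 2 * (i + 1 / 4) ^ 2 * (i + 3 / 4) ^ 2) /
    ((2 * i + 1) * (2 * i + 2) * (2 * i + a + 1 / 4) * (2 * i + a + 3 / 4)
      * (2 * i + a + 5 / 4) * (2 * i + a + 7 / 4))

/-- The rational factor of the accelerated series; at fixed `x` it is asymptotic to `a` as `a`
tends to infinity. -/
noncomputable def accFactor (a x : ℝ) : ℝ :=
  (13 / 16 * a ^ 2 + a ^ 3 + x * (3 / 8 + 29 / 8 * a + 8 * a ^ 2 + 2 * a ^ 3)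
    + x ^ 2 * (89 / 16 + 21 * a + 13 * a ^ 2) + x ^ 3 * (20 + 28 * a) + 21 * x ^ 4)
    / ((2 * x + 1) * (2 * x + a + 1 / 4) * (2 * x + a + 3 / 4))

/-- The summand of the accelerated series. -/
noncomputable def accSummand (a : ℝ) (n : ℕ) : ℝ := accTerm a n * accFactor a n

theorem accTerm_zero (a : ℝ) : accTerm a 0 = 1 := by simp [accTerm]

theorem accTerm_succ (a : ℝ) (n : ℕ) :
    accTerm a (n + 1) = accTerm a n *
      ((((n : ℝ) + a) ^ 2 * (n + 1 / 4) ^ 2 * (n + 3 / 4) ^ 2) /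
        ((2 * n + 1) * (2 * n + 2) * (2 * n + a + 1 / 4) * (2 * n + a + 3 / 4)
          * (2 * n + a + 5 / 4) * (2 * n + a + 7 / 4))) :=
  prod_range_succ _ _

theorem accTerm_nonneg {a : ℝ} (ha : 0 < a) (n : ℕ) : 0 ≤ accTerm a n :=
  prod_nonneg fun i _ => by positivity

theorem accTerm_add_one {a : ℝ} (ha : 0 < a) (n : ℕ) :
    accTerm (a + 1) n = accTerm a n * ((a + n) ^ 2 / a ^ 2 * ((a + 1 / 4) * (a + 3 / 4))
      / ((2 * n + a + 1 / 4) * (2 * n + a + 3 / 4))) := by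
  induction n with
  | zero =>
    simp only [accTerm_zero, Nat.cast_zero, mul_zero, zero_add, add_zero]
    field_simp
  | succ n ih =>
    rw [accTerm_succ, accTerm_succ, ih]
    push_cast
    field_simp
    ring

theorem accTerm_ratio_le {a x : ℝ} (ha : 0 < a) (hx : 0 ≤ x) :
    ((x + a) ^ 2 * (x + 1 / 4) ^ 2 * (x + 3 / 4) ^ 2) /
      ((2 * x + 1) * (2 * x + 2) * (2 * x + a + 1 / 4) * (2 * x + a + 3 / 4)
        * (2 * x + a + 5 / 4) * (2 * x + a + 7 / 4)) ≤ 1 / 4 := by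
  rw [div_le_div_iff₀ (by positivity) (by norm_num)]
  calc (x + a) ^ 2 * (x + 1 / 4) ^ 2 * (x + 3 / 4) ^ 2 * 4
      = (2 * (x + 1 / 4)) * (2 * (x + 3 / 4)) * (x + 1 / 4) * (x + 3 / 4) * (x + a) * (x + a) := by
        ring
    _ ≤ (2 * x + 1) * (2 * x + 2) * (2 * x + a + 1 / 4) * (2 * x + a + 3 / 4)
        * (2 * x + a + 5 / 4) * (2 * x + a + 7 / 4) := by
        gcongr ?_ * ?_ * ?_ * ?_ * ?_ * ?_ <;> linarith
    _ = _ := by ring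

/-- The factor `1 / a ^ 2` makes all terms but the first negligible for large `a`. -/
theorem accTerm_succ_le {a : ℝ} (ha : 0 < a) (n : ℕ) :
    accTerm a (n + 1) ≤ 1 / a ^ 2 * (1 / 4) ^ n := by
  induction n with
  | zero =>
    rw [accTerm_succ, accTerm_zero, pow_zero, mul_one, one_mul, Nat.cast_zero,
      div_le_div_iff₀ (by positivity) (by positivity)]
    calc (0 + a) ^ 2 * (0 + 1 / 4 : ℝ) ^ 2 * (0 + 3 / 4) ^ 2 * a ^ 2
        ≤ 2 * (a * a * a * a) := by nlinarith [pow_pos ha 4]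
      _ ≤ 2 * ((2 * 0 + a + 1 / 4) * (2 * 0 + a + 3 / 4)
        * (2 * 0 + a + 5 / 4) * (2 * 0 + a + 7 / 4)) := by gcongr <;> linarith
      _ = _ := by ring
  | succ n ih =>
    rw [accTerm_succ, pow_succ (1 / 4 : ℝ), ← mul_assoc]
    exact mul_le_mul ih (accTerm_ratio_le ha (Nat.cast_nonneg _)) (by positivity) (by positivity)

theorem summable_pow_mul_accTerm {a : ℝ} (ha : 0 < a) (k : ℕ) :
    Summable fun n : ℕ => (n : ℝ) ^ k * accTerm a n := by
  rw [← summable_nat_add_iff 1]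
  have h : Summable fun n : ℕ => ((n + 1 : ℕ) : ℝ) ^ k * (1 / 4 : ℝ) ^ (n + 1) :=
    (summable_nat_add_iff 1).mpr
      (summable_pow_mul_geometric_of_norm_lt_one (r := (1 / 4 : ℝ)) k (by norm_num))
  refine Summable.of_nonneg_of_le
    (fun n => mul_nonneg (by positivity) (accTerm_nonneg ha _)) (fun n => ?_)
    (h.mul_left (4 / a ^ 2))
  refine (mul_le_mul_of_nonneg_left (accTerm_succ_le ha n) (by positivity)).trans (le_of_eq ?_)
  rw [pow_succ (1 / 4 : ℝ)]
  ring

theorem accFactor_nonneg {a x : ℝ} (ha : 0 < a) (hx : 0 ≤ x) : 0 ≤ accFactor a x := by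
  unfold accFactor
  positivity

theorem accFactor_le {a x : ℝ} (ha : 0 < a) (hx : 0 ≤ x) : accFactor a x ≤ 10 * (x + a + 1) := by
  unfold accFactor
  rw [div_le_iff₀ (by positivity), ← sub_nonneg]
  ring_nf
  positivity

theorem accSummand_nonneg {a : ℝ} (ha : 0 < a) (n : ℕ) : 0 ≤ accSummand a n :=
  mul_nonneg (accTerm_nonneg ha n) (accFactor_nonneg ha (Nat.cast_nonneg n))

theorem accSummand_succ_le {a : ℝ} (ha : 0 < a) (n : ℕ) :
    accSummand a (n + 1) ≤ 10 * (a + 2) / a ^ 2 * (1 / 2) ^ n := by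
  have hn : ((n : ℝ) + 1) ≤ 2 ^ n := by exact_mod_cast Nat.lt_two_pow_self
  have hfac : accFactor a ((n + 1 : ℕ) : ℝ) ≤ 10 * ((a + 2) * 2 ^ n) := by
    refine (accFactor_le ha (Nat.cast_nonneg _)).trans ?_
    push_cast
    nlinarith [mul_le_mul_of_nonneg_left hn (by linarith : 0 ≤ a + 2),
      mul_nonneg ha.le (Nat.cast_nonneg (α := ℝ) n), Nat.cast_nonneg (α := ℝ) n]
  refine (mul_le_mul (accTerm_succ_le ha n) hfac (accFactor_nonneg ha (Nat.cast_nonneg _))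
    (by positivity)).trans (le_of_eq ?_)
  rw [show (1 / 4 : ℝ) = 1 / 2 * (1 / 2) by norm_num, mul_pow]
  have h2 : (1 / 2 : ℝ) ^ n * 2 ^ n = 1 := by rw [← mul_pow]; norm_num
  linear_combination (10 * (a + 2) / a ^ 2 * (1 / 2) ^ n) * h2

theorem summable_accSummand {a : ℝ} (ha : 0 < a) : Summable (accSummand a) :=
  (abs_tsum_sub_zero_le (accSummand_nonneg ha) (accSummand_succ_le ha)).1

/-- The Wilf-Zeilberger certificate `2 n` for the shift `a ↦ a + 1`. -/
theorem accSummand_shift {a : ℝ} (ha : 0 < a) (n : ℕ) :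
    a ^ 2 / ((a + 1 / 4) * (a + 3 / 4)) * accSummand (a + 1) n
      = accSummand a n + (2 * ((n + 1 : ℕ) : ℝ) * accTerm a (n + 1) - 2 * n * accTerm a n) := by
  rw [accSummand, accSummand, accTerm_add_one ha, accTerm_succ, accFactor, accFactor]
  push_cast
  have hn : (0 : ℝ) ≤ n := Nat.cast_nonneg n
  rw [show 2 * (n : ℝ) + (a + 1) + 1 / 4 = 2 * n + a + 5 / 4 by ring,
    show 2 * (n : ℝ) + (a + 1) + 3 / 4 = 2 * n + a + 7 / 4 by ring]
  field_simp
  ring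

theorem tsum_accSummand_add_one {a : ℝ} (ha : 0 < a) :
    ∑' n, accSummand a n
      = a ^ 2 / ((a + 1 / 4) * (a + 3 / 4)) * ∑' n, accSummand (a + 1) n := by
  have hsum : Summable fun n : ℕ => 2 * (n : ℝ) * accTerm a n := by
    simpa [mul_assoc] using (summable_pow_mul_accTerm ha 1).mul_left 2
  exact (hasSum_add_telescope (summable_accSummand ha).hasSum hsum (by simp)
    (accSummand_shift ha)).unique
    ((summable_accSummand (by linarith : 0 < a + 1)).hasSum.mul_left _)

/-- Iterating the shift gives the factors `(j + 1/4)² / ((j + 1/2) (j + 1))`, whose product tends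
to `0`. Moving the factor `m + 1/4`, which is the asymptotic size of the shifted sum, into the
product turns one `j + 1/4` into `j + 5/4`, and the product then has a positive limit. -/
theorem tsum_accSummand_one_quarter (m : ℕ) :
    ∑' n, accSummand (1 / 4) n =
      1 / 4 * (∏ j ∈ range m, (((j : ℝ) + 1 / 4) * (j + 5 / 4)) / ((j + 1 / 2) * (j + 1)))
        * ((∑' n, accSummand (m + 1 / 4) n) / (m + 1 / 4)) := by
  induction m with
  | zero =>
    simp only [range_zero, prod_empty, Nat.cast_zero, zero_add]
    ring
  | succ m ih =>
    rw [ih, prod_range_succ, tsum_accSummand_add_one (by positivity : 0 < (m : ℝ) + 1 / 4),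
      show ((m : ℝ) + 1 / 4 + 1) = ((m + 1 : ℕ) : ℝ) + 1 / 4 by push_cast; ring]
    generalize ∏ j ∈ range m, (((j : ℝ) + 1 / 4) * (j + 5 / 4)) / ((j + 1 / 2) * (j + 1)) = P
    generalize ∑' n, accSummand (((m + 1 : ℕ) : ℝ) + 1 / 4) n = S
    push_cast
    field_simp
    ring

theorem tendsto_tsum_accSummand_div :
    Tendsto (fun m : ℕ => (∑' n, accSummand (m + 1 / 4) n) / (m + 1 / 4)) atTop (𝓝 1) := by
  rw [tendsto_iff_norm_sub_tendsto_zero]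
  have hlim : Tendsto (fun m : ℕ => 2884 * (1 / ((m : ℝ) + 1))) atTop (𝓝 0) := by
    simpa using (tendsto_one_div_add_atTop_nhds_zero_nat (𝕜 := ℝ)).const_mul 2884
  refine squeeze_zero (fun _ => norm_nonneg _) (fun m => ?_) hlim
  have hm : (0 : ℝ) ≤ m := Nat.cast_nonneg m
  obtain ⟨a, ha⟩ : ∃ a : ℝ, a = m + 1 / 4 := ⟨_, rfl⟩
  have ha0 : 1 / 4 ≤ a := by linarith
  have hapos : 0 < a := by linarith
  have h := (abs_tsum_sub_zero_le (accSummand_nonneg hapos) (accSummand_succ_le hapos)).2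
  -- The term of index `0` is `a ^ 2 * (a + 13 / 16) / ((a + 1 / 4) * (a + 3 / 4))`.
  have h0 : |accSummand a 0 - a| ≤ 1 := by
    have : accSummand a 0 - a = -(3 / 16 * a * (a + 1)) / ((a + 1 / 4) * (a + 3 / 4)) := by
      rw [accSummand, accTerm_zero, accFactor]
      field_simp
      norm_num
      ring
    rw [this, abs_div, abs_neg, abs_of_pos (by positivity), abs_of_pos (by positivity),
      div_le_one (by positivity)]
    nlinarith
  rw [← ha, Real.norm_eq_abs, div_sub_one hapos.ne', abs_div, abs_of_pos hapos]
  rw [show (m : ℝ) + 1 = a + 3 / 4 by linarith]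
  -- The bound on the remaining terms decreases in `a`, and its value at `a = 1 / 4` is `720`.
  have h1 : 2 * (10 * (a + 2) / a ^ 2) ≤ 720 := by
    rw [mul_div_assoc', div_le_iff₀ (by positivity)]
    nlinarith
  have h2 : |∑' n, accSummand a n - a| ≤ 721 :=
    (abs_sub_le _ (accSummand a 0) _).trans (by linarith)
  -- `2884 = 4 * 721`, because `a + 3 / 4 ≤ 4 * a`.
  rw [mul_one_div, div_le_div_iff₀ hapos (by positivity)]
  nlinarith

theorem tsum_accSummand_eq :
    ∑' n, accSummand (1 / 4) n = Real.sqrt Real.pi / Real.Gamma (1 / 4) ^ 2 := by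
  have h := ((tendsto_prod_shift_div (a := 1 / 4) (b := 5 / 4) (c := 1 / 2) (d := 1)
    (by norm_num) (by norm_num) (by norm_num) (by norm_num) (by norm_num)).const_mul (1 / 4)).mul
    tendsto_tsum_accSummand_div
  have hG : Real.Gamma (5 / 4) = 1 / 4 * Real.Gamma (1 / 4) := by
    rw [← Real.Gamma_add_one (by norm_num)]
    norm_num
  have hpos : 0 < Real.Gamma (1 / 4) := Real.Gamma_pos_of_pos (by norm_num)
  rw [tendsto_nhds_unique (tendsto_const_nhds.congr fun m => tsum_accSummand_one_quarter m) h,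
    Real.Gamma_one_half_eq, Real.Gamma_one, hG]
  field_simp

/-! ### The series of the theorem -/

/-- At `a = 1/4` the factor `(1/4)_n (3/4)_n` of `accTerm` cancels against
`(1/2)_{2n} = 4ⁿ (1/4)_n (3/4)_n`, which leaves the hypergeometric term of the theorem. -/
theorem choose_mul_ascPochhammer_eq_accTerm (n : ℕ) :
    (Nat.choose (4 * n) (2 * n) : ℝ) * ((ascPochhammer ℝ n).eval (1 / 4 : ℝ)) ^ 2
      / (Nat.factorial (2 * n) : ℝ) / 2 ^ (8 * n) = accTerm (1 / 4) n := by
  rw [show 4 * n = 2 * (2 * n) by ring, ← Nat.centralBinom_eq_two_mul_choose]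
  induction n with
  | zero => simp [accTerm_zero]
  | succ n ih =>
    have h1 : ((2 * n : ℕ) + 1 : ℝ) * (Nat.centralBinom (2 * n + 1) : ℝ)
        = 2 * (2 * (2 * n : ℕ) + 1) * Nat.centralBinom (2 * n) := by
      exact_mod_cast Nat.succ_mul_centralBinom_succ (2 * n)
    have h2 : ((2 * n + 1 : ℕ) + 1 : ℝ) * (Nat.centralBinom (2 * n + 2) : ℝ)
        = 2 * (2 * (2 * n + 1 : ℕ) + 1) * Nat.centralBinom (2 * n + 1) := by
      exact_mod_cast Nat.succ_mul_centralBinom_succ (2 * n + 1)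
    have h3 : (Nat.centralBinom (2 * n + 2) : ℝ) = 4 * (4 * n + 1) * (4 * n + 3)
        / ((2 * n + 1) * (2 * n + 2)) * Nat.centralBinom (2 * n) := by
      push_cast at h1 h2
      field_simp
      linear_combination (2 * (n : ℝ) + 1) * h2 + 2 * (4 * (n : ℝ) + 3) * h1
    rw [accTerm_succ, ← ih, ascPochhammer_succ_eval, show 2 * (n + 1) = 2 * n + 2 by ring, h3,
      Nat.factorial_succ, Nat.factorial_succ, show 8 * (n + 1) = 8 * n + 8 by ring, pow_add]
    have : ((2 * n).factorial : ℝ) ≠ 0 := by positivity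
    push_cast
    field_simp
    ring

/-- The terms of the theorem and `32 * accSummand (1/4)` differ by a telescoping term with the
certificate `1024 n² (4 n - 3)`, which is expanded here. -/
theorem target_eq_accSummand_add (n : ℕ) :
    accTerm (1 / 4) n * (5 + 92 * (n : ℝ) + 3120 * (n : ℝ) ^ 2 - 4032 * (n : ℝ) ^ 3)
      = 32 * accSummand (1 / 4) n
        + ((4096 * ((n + 1 : ℕ) : ℝ) ^ 3 - 3072 * ((n + 1 : ℕ) : ℝ) ^ 2) * accTerm (1 / 4) (n + 1)
          - (4096 * (n : ℝ) ^ 3 - 3072 * (n : ℝ) ^ 2) * accTerm (1 / 4) n) := by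
  rw [accSummand, accTerm_succ, accFactor]
  push_cast
  field_simp
  ring

theorem mainTheorem6 :
    HasSum
      (fun n : ℕ =>
        ((Nat.choose (4 * n) (2 * n) : ℝ) * ((ascPochhammer ℝ n).eval (1 / 4 : ℝ)) ^ 2
            / (Nat.factorial (2 * n) : ℝ))
          * ((5 + 92 * (n : ℝ) + 3120 * (n : ℝ) ^ 2 - 4032 * (n : ℝ) ^ 3) / 2 ^ (8 * n)))
      (8 / ellipticK (1 / Real.sqrt 2)) ∧
    8 / ellipticK (1 / Real.sqrt 2)
      = 32 * Real.sqrt Real.pi / Real.Gamma (1 / 4) ^ 2 := by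
  have hK : 8 / ellipticK (1 / Real.sqrt 2)
      = 32 * Real.sqrt Real.pi / Real.Gamma (1 / 4) ^ 2 := by
    rw [ellipticK_one_div_sqrt_two, div_div_eq_mul_div]
    ring
  refine ⟨?_, hK⟩
  have hpos : (0 : ℝ) < 1 / 4 := by norm_num
  have hsum : Summable fun n : ℕ =>
      (4096 * (n : ℝ) ^ 3 - 3072 * (n : ℝ) ^ 2) * accTerm (1 / 4) n :=
    (((summable_pow_mul_accTerm hpos 3).mul_left 4096).sub
      ((summable_pow_mul_accTerm hpos 2).mul_left 3072)).congr fun n => by ring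
  have hacc := (summable_accSummand hpos).hasSum.mul_left 32
  rw [tsum_accSummand_eq] at hacc
  rw [hK, mul_div_assoc]
  refine hasSum_add_telescope hacc hsum (by simp) fun n => ?_
  rw [← target_eq_accSummand_add, ← choose_mul_ascPochhammer_eq_accTerm]
  ring
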